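/- Let $m\ge 2$ and $n\ge 1$ be integers, and let $\mathcal{A}=(a_{i_1i_2\cdots i_m})$, $i_1,\dots,i_m\in\{1,\dots,n\}$, be an $m$-order $n$-dimensional real tensor (not assumed symmetric). For $x\in\mathbb{R}^n$ let $\mathcal{A}x^{m-1}\in\mathbb{R}^n$ be the vector with entries $$(\mathcal{A}x^{m-1})_i=\sum_{i_2,\dots,i_m=1}^n a_{ii_2\cdots i_m}x_{i_2}\cdots x_{i_m},\qquad i=1,\dots,n,$$ and let $\mathcal{A}x^m=\sum_{i_1,\dots,i_m=1}^n a_{i_1\cdots i_m}x_{i_1}\cdots x_{i_m}$. Let $X\subseteq\mathbb{R}^n$ be a nonempty closed convex set with $0\in X$, and suppose that $\mathcal{A}$ is positive definite on $X$, i.e. $\mathcal{A}x^m>0$ for all $x\in X$ with $x\ne 0$. Then, for every $q\in\mathbb{R}^n$, the solution set of the tensor variational inequality $\mathrm{TVI}(X,\mathcal{A},q)$, that is, the set $$\{x^*\in X:\ \langle y-x^*,\ \mathcal{A}(x^*)^{m-1}+q\rangle\ge 0\ \text{ for all } y\in X\},$$ is nonempty and compact. -/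

import Mathlib

/-- An `m`-order `n`-dimensional real tensor `(a_{i₁ i₂ ⋯ i_m})`. -/
abbrev RealTensor (m n : ℕ) : Type := (Fin m → Fin n) → ℝ

namespace RealTensor

/-- The multi-index `(i, j₁, …, j_{m-1})` of length `m`. -/
def consIndex {m n : ℕ} (i : Fin n) (j : Fin (m - 1) → Fin n) : Fin m → Fin n :=
  fun k => if h : k.val = 0 then i else j ⟨k.val - 1, by omega⟩

/-- The vector `𝒜 x^{m-1}`, with entries
`(𝒜 x^{m-1})_i = ∑_{i₂, …, i_m} a_{i i₂ ⋯ i_m} x_{i₂} ⋯ x_{i_m}`. -/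
noncomputable def applyVec {m n : ℕ} (A : RealTensor m n) (x : EuclideanSpace ℝ (Fin n)) :
    EuclideanSpace ℝ (Fin n) :=
  WithLp.toLp 2 fun i => ∑ j : Fin (m - 1) → Fin n, A (consIndex i j) * ∏ k, x (j k)

/-- The number `𝒜 x^m = ∑_{i₁, …, i_m} a_{i₁ ⋯ i_m} x_{i₁} ⋯ x_{i_m}`. -/
noncomputable def applyScalar {m n : ℕ} (A : RealTensor m n) (x : EuclideanSpace ℝ (Fin n)) : ℝ :=
  ∑ j : Fin m → Fin n, A j * ∏ k, x (j k)

/-- `𝒜` is positive definite on `X`: `𝒜 x^m > 0` for all nonzero `x ∈ X`. -/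
def PosDefOn {m n : ℕ} (A : RealTensor m n) (X : Set (EuclideanSpace ℝ (Fin n))) : Prop :=
  ∀ x ∈ X, x ≠ 0 → 0 < A.applyScalar x

end RealTensor

/-- The solution set of the variational inequality `VI(X, F)`: all `x ∈ X` with
`⟨y - x, F x⟩ ≥ 0` for every `y ∈ X`. -/
def viSolutionSet {n : ℕ} (X : Set (EuclideanSpace ℝ (Fin n)))
    (F : EuclideanSpace ℝ (Fin n) → EuclideanSpace ℝ (Fin n)) :
    Set (EuclideanSpace ℝ (Fin n)) :=
  {x | x ∈ X ∧ ∀ y ∈ X, 0 ≤ inner ℝ (y - x) (F x)}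

/-- The solution set of the tensor variational inequality `TVI(X, 𝒜, q)`, that is,
of `VI(X, F)` with `F x = 𝒜 x^{m-1} + q`. -/
noncomputable def tviSolutionSet {m n : ℕ} (X : Set (EuclideanSpace ℝ (Fin n)))
    (A : RealTensor m n) (q : EuclideanSpace ℝ (Fin n)) : Set (EuclideanSpace ℝ (Fin n)) :=
  viSolutionSet X fun x => A.applyVec x + q

/-! By homogeneity and compactness of the unit sphere, positive definiteness gives `c‖x‖^m ≤ 𝒜x^m`
for `x ∈ X` with `‖x‖ ≥ 1`. As `m ≥ 2`, the points of `X` with `⟨x, F x⟩ ≤ 0`, where `F x = 𝒜x^{m-1}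
+ q`, are bounded. Testing with `y = 0` puts every solution among them, so the closed solution set
is compact. For existence, solve on `X ∩ closedBall 0 (R + 1)`; the solution has norm at most `R`,
so the truncation is inactive.

The compact case (`exists_variationalInequality_solution`) is a fixed point of a map built from the
metric projection. Lipschitz maps suffice, since `F` is C¹. Brouwer's theorem for them rests on
`not_exists_lipschitz_retraction`, proved by volume: `∫ det (1 + t Dh)` over the ball is polynomial
in `t` and equals the volume for small `t`, hence also at `t = 1`, where a retraction would make it
zero. -/

section

open MeasureTheory Module Metric Filter
open scoped NNReal ENNReal

/-! ### Determinants of perturbations of the identity. -/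

section DetInterpolation
variable {E : Type*} [NormedAddCommGroup E] [NormedSpace ℝ E] [FiniteDimensional ℝ E]

/-- `s ↦ det (1 + s L)` is a polynomial of degree at most the dimension, so it is determined by
its values at any `finrank ℝ E + 1` nodes. -/
theorem ContinuousLinearMap.det_one_add_smul_eq_sum_basis (L : E →L[ℝ] E)
    (v : Fin (finrank ℝ E + 1) → ℝ) (hv : Function.Injective v) (s : ℝ) :
    (1 + s • L).det =
      ∑ j, (Lagrange.basis Finset.univ v j).eval s * (1 + v j • L).det := by
  let b := finBasis ℝ E
  let M := LinearMap.toMatrix b b (L : E →ₗ[ℝ] E)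
  let p : Polynomial ℝ :=
    Matrix.det ((Polynomial.X : Polynomial ℝ) • M.map Polynomial.C +
      (1 : Matrix (Fin (finrank ℝ E)) (Fin (finrank ℝ E)) ℝ).map Polynomial.C)
  have hp : ∀ t : ℝ, p.eval t = (1 + t • L).det := by
    intro t
    rw [ContinuousLinearMap.det, ← LinearMap.det_toMatrix b]
    have h1 : LinearMap.toMatrix b b ((1 + t • L : E →L[ℝ] E) : E →ₗ[ℝ] E) = 1 + t • M := by
      have : ((1 + t • L : E →L[ℝ] E) : E →ₗ[ℝ] E) = LinearMap.id + t • (L : E →ₗ[ℝ] E) := rfl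
      rw [this, map_add, map_smul, LinearMap.toMatrix_id]
    rw [h1]
    rw [← Polynomial.coe_evalRingHom, RingHom.map_det]
    congr 1
    ext i j
    simp [Matrix.one_apply, apply_ite (Polynomial.eval t), add_comm]
    exact mul_comm _ _
  have hdeg : p.degree < (Finset.univ : Finset (Fin (finrank ℝ E + 1))).card := by
    refine lt_of_le_of_lt Polynomial.degree_le_natDegree ?_
    have := Polynomial.natDegree_det_X_add_C_le M 1
    rw [Fintype.card_fin] at this
    rw [Finset.card_univ, Fintype.card_fin]
    exact_mod_cast Nat.lt_succ_of_le this
  have h2 := Lagrange.eq_interpolate (s := Finset.univ) (v := v) hv.injOn hdeg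
  rw [← hp s]
  conv_lhs => rw [h2]
  simp only [Lagrange.interpolate_apply, Polynomial.eval_finsetSum, Polynomial.eval_mul,
    Polynomial.eval_C, hp]
  exact Finset.sum_congr rfl fun j _ => mul_comm _ _

/-- The determinant of `1 + t • L` never vanishes for `t ∈ [0, 1]` and is `1` at `t = 0`, so it
cannot change sign. -/
theorem ContinuousLinearMap.det_one_add_pos {L : E →L[ℝ] E} (hL : ‖L‖ < 1) :
    0 < (1 + L).det := by
  have hne : ∀ t ∈ Set.Icc (0 : ℝ) 1, (1 + t • L).det ≠ 0 := by
    intro t ht h0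
    obtain ⟨x, hx, hx0⟩ : ∃ x, (1 + t • L) x = 0 ∧ x ≠ 0 := by
      have := LinearMap.bot_lt_ker_of_det_eq_zero (f := ((1 + t • L : E →L[ℝ] E) : E →ₗ[ℝ] E)) h0
      obtain ⟨x, hx, hx0⟩ := (Submodule.ne_bot_iff _).1 this.ne'
      exact ⟨x, hx, hx0⟩
    have h1 : x = -(t • L x) := by
      have : x + t • L x = 0 := by simpa using hx
      exact eq_neg_of_add_eq_zero_left this
    have h2 : ‖x‖ ≤ ‖L‖ * ‖x‖ := by
      calc ‖x‖ = ‖t • L x‖ := by rw [← norm_neg (t • L x), ← h1]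
        _ = t * ‖L x‖ := by rw [norm_smul, Real.norm_of_nonneg ht.1]
        _ ≤ 1 * ‖L x‖ := by gcongr; exact ht.2
        _ ≤ ‖L‖ * ‖x‖ := by rw [one_mul]; exact L.le_opNorm x
    have h3 : 0 < ‖x‖ := norm_pos_iff.2 hx0
    nlinarith
  have hc : ContinuousOn (fun t : ℝ => (1 + t • L).det) (Set.Icc 0 1) :=
    (ContinuousLinearMap.continuous_det.comp (by fun_prop)).continuousOn
  by_contra hneg
  have h0 : (1 + (0 : ℝ) • L).det = 1 := by
    simp [ContinuousLinearMap.det, ContinuousLinearMap.one_def]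
  have := intermediate_value_Icc' (zero_le_one' ℝ) hc
  obtain ⟨t, ht, ht0⟩ := this (show (0 : ℝ) ∈ Set.Icc _ _ by
    simp only [h0, one_smul]
    exact ⟨not_lt.1 hneg, zero_le_one⟩)
  exact hne t ht ht0

end DetInterpolation

/-! ### The Jacobian integral of a Lipschitz perturbation of the identity. -/

section VolumePreservation
variable {E : Type*} [NormedAddCommGroup E] [NormedSpace ℝ E] [FiniteDimensional ℝ E]

theorem bijective_id_add_of_lipschitzWith {h : E → E} {K : ℝ≥0} (hh : LipschitzWith K h)
    (hK : K < 1) : Function.Bijective fun x => x + h x := by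
  have hap : ApproximatesLinearOn (fun x => x + h x)
      ((ContinuousLinearEquiv.refl ℝ E : E ≃L[ℝ] E) : E →L[ℝ] E) Set.univ K := by
    intro x _ y _
    have : x + h x - (y + h y) - (ContinuousLinearEquiv.refl ℝ E : E →L[ℝ] E) (x - y)
        = h x - h y := by simp; abel
    rw [this]
    exact hh.norm_sub_le x y
  have hc : Subsingleton E ∨
      K < ‖((ContinuousLinearEquiv.refl ℝ E).symm : E →L[ℝ] E)‖₊⁻¹ := by
    rcases subsingleton_or_nontrivial E with hE | hE
    · exact Or.inl hE
    · right
      have : ‖((ContinuousLinearEquiv.refl ℝ E).symm : E →L[ℝ] E)‖₊ = 1 := by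
        have : ((ContinuousLinearEquiv.refl ℝ E).symm : E →L[ℝ] E)
          = ContinuousLinearMap.id ℝ E := rfl
        rw [this]
        exact NNReal.eq ContinuousLinearMap.norm_id
      rw [this]; simpa using hK
  have : CompleteSpace E := FiniteDimensional.complete ℝ E
  exact ⟨Set.injOn_univ.1 (hap.injOn hc), hap.surjective hc⟩

/-- The map is a bijection fixing every point outside the ball, so injectivity keeps points of the
ball from leaving it. -/
theorem image_closedBall_id_add {h : E → E} {K : ℝ≥0} {r : ℝ} (hh : LipschitzWith K h)
    (hK : K < 1) (h0 : ∀ x, r ≤ ‖x‖ → h x = 0) :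
    (fun x => x + h x) '' closedBall 0 r = closedBall 0 r := by
  obtain ⟨hinj, hsurj⟩ := bijective_id_add_of_lipschitzWith hh hK
  have key : ∀ x, r < ‖x‖ ↔ r < ‖x + h x‖ := by
    intro x
    constructor
    · intro hx
      rwa [h0 x hx.le, add_zero]
    · intro hx
      have h1 : (fun x => x + h x) (x + h x) = (fun x => x + h x) x := by
        simp [h0 _ hx.le]
      have h2 := hinj h1
      rwa [h2] at hx
  ext y
  constructor
  · rintro ⟨x, hx, rfl⟩
    rw [mem_closedBall_zero_iff] at hx ⊢
    exact not_lt.1 fun h => not_lt.2 hx ((key x).2 h)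
  · intro hy
    obtain ⟨x, rfl⟩ := hsurj y
    refine ⟨x, ?_, rfl⟩
    rw [mem_closedBall_zero_iff] at hy ⊢
    exact not_lt.1 fun h => not_lt.2 hy ((key x).1 h)

variable [MeasurableSpace E] [BorelSpace E]

theorem integrableOn_det_one_add_smul_fderiv {h : E → E} {K : ℝ≥0} (hh : LipschitzWith K h)
    (μ : Measure E) [IsFiniteMeasureOnCompacts μ] (t r : ℝ) :
    IntegrableOn (fun x => (1 + t • fderiv ℝ h x).det) (closedBall 0 r) μ := by
  have hE : ProperSpace E := FiniteDimensional.proper_real E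
  have hEE : ProperSpace (E →L[ℝ] E) := FiniteDimensional.proper_real _
  have hcont : Continuous fun L : E →L[ℝ] E => (1 + t • L).det :=
    ContinuousLinearMap.continuous_det.comp (by fun_prop)
  obtain ⟨C, hC⟩ := ((isCompact_closedBall (0 : E →L[ℝ] E) K).image hcont).isBounded.exists_norm_le
  have : CompleteSpace E := FiniteDimensional.complete ℝ E
  refine Measure.integrableOn_of_bounded (M := C)
    (isCompact_closedBall (0 : E) r).measure_lt_top.ne ?_ ?_
  · exact (hcont.measurable.comp (measurable_fderiv ℝ h)).aestronglyMeasurable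
  · refine Eventually.of_forall fun x => hC _ ⟨fderiv ℝ h x, ?_, rfl⟩
    rw [mem_closedBall_zero_iff]
    exact norm_fderiv_le_of_lipschitz ℝ hh

/-- Change of variables: `id + h` is injective with positive Jacobian and maps the ball onto itself.
-/
theorem setIntegral_det_one_add_fderiv_of_lt_one {h : E → E} {K : ℝ≥0} {r : ℝ}
    (hh : LipschitzWith K h) (hK : K < 1) (h0 : ∀ x, r ≤ ‖x‖ → h x = 0) :
    ∫ x in closedBall 0 r, (1 + fderiv ℝ h x).det ∂(μH[finrank ℝ E] : Measure E) =
      (μH[finrank ℝ E] : Measure E).real (closedBall 0 r) := by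
  set μ : Measure E := μH[finrank ℝ E] with hμ
  have : CompleteSpace E := FiniteDimensional.complete ℝ E
  set g : E → E := fun x => x + h x with hg
  have hgL : LipschitzWith (1 + K) g := LipschitzWith.id.add hh
  let D : Set E := {x | DifferentiableAt ℝ h x}
  have hD : MeasurableSet D := measurableSet_of_differentiableAt ℝ h
  have hDc : μ Dᶜ = 0 := hh.ae_differentiableAt
  have hpos : ∀ x, 0 < (1 + fderiv ℝ h x).det := fun x =>
    ContinuousLinearMap.det_one_add_pos
      ((norm_fderiv_le_of_lipschitz ℝ hh).trans_lt (by exact_mod_cast hK))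
  have hcv := lintegral_abs_det_fderiv_eq_addHaar_image μ
    (s := closedBall 0 r ∩ D) (f := g) (f' := fun x => 1 + fderiv ℝ h x)
    (isClosed_closedBall.measurableSet.inter hD)
    (fun x hx => ((hasFDerivAt_id x).add hx.2.hasFDerivAt).hasFDerivWithinAt)
    ((bijective_id_add_of_lipschitzWith hh hK).1.injOn)
  have himg : μ (g '' (closedBall 0 r ∩ D)) = μ (closedBall 0 r) := by
    refine le_antisymm ?_ ?_
    · conv_rhs => rw [← image_closedBall_id_add hh hK h0]
      exact measure_mono (Set.image_mono Set.inter_subset_left)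
    · conv_lhs => rw [← image_closedBall_id_add hh hK h0]
      have h1 : (fun x => x + h x) '' closedBall 0 r ⊆ g '' (closedBall 0 r ∩ D) ∪ g '' Dᶜ := by
        rintro _ ⟨x, hx, rfl⟩
        by_cases hxD : x ∈ D
        · exact Or.inl ⟨x, ⟨hx, hxD⟩, rfl⟩
        · exact Or.inr ⟨x, hxD, rfl⟩
      -- `Dᶜ` is null by Rademacher's theorem; Hausdorff measure makes it immediate that its
      -- Lipschitz image is null too.
      have h2 : μ (g '' Dᶜ) = 0 := by
        have := hgL.hausdorffMeasure_image_le (d := finrank ℝ E) (by positivity) Dᶜ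
        rw [← hμ, hDc, mul_zero] at this
        exact le_antisymm this bot_le
      calc _ ≤ _ := measure_mono h1
        _ ≤ _ := measure_union_le _ _
        _ = _ := by rw [h2, add_zero]
  have hae : (closedBall 0 r ∩ D : Set E) =ᵐ[μ] (closedBall 0 r : Set E) :=
    inter_ae_eq_left_of_ae_eq_univ (eventuallyEq_univ.2 hDc)
  rw [himg, setLIntegral_congr hae] at hcv
  rw [integral_eq_lintegral_of_nonneg_ae (Eventually.of_forall fun x => (hpos x).le)]
  · rw [Measure.real, ← hcv]
    congr 1
    exact lintegral_congr fun x => by rw [abs_of_pos (hpos x)]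
  · simpa using (integrableOn_det_one_add_smul_fderiv hh μ 1 r).aestronglyMeasurable

/-- The contraction case applies to `t • h` when `t` is small; polynomial dependence on `t` carries
the value to `t = 1`. -/
theorem setIntegral_det_one_add_fderiv {h : E → E} {K : ℝ≥0} {r : ℝ}
    (hh : LipschitzWith K h) (h0 : ∀ x, r ≤ ‖x‖ → h x = 0) :
    ∫ x in closedBall 0 r, (1 + fderiv ℝ h x).det ∂(μH[finrank ℝ E] : Measure E) =
      (μH[finrank ℝ E] : Measure E).real (closedBall 0 r) := by
  set μ : Measure E := μH[finrank ℝ E] with hμ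
  -- Distinct nodes with `v j * K < 1`, so each `v j • h` is a contraction.
  let v : Fin (finrank ℝ E + 1) → ℝ := fun j => ((K : ℝ) + 1 + j)⁻¹
  have hv : Function.Injective v := by
    intro i j hij
    have := inv_injective hij
    exact Fin.ext (by exact_mod_cast add_left_cancel this)
  have hvj : ∀ j, ∫ x in closedBall 0 r, (1 + v j • fderiv ℝ h x).det ∂μ =
      μ.real (closedBall 0 r) := by
    intro j
    have hL : LipschitzWith (‖v j‖₊ * K) (fun x => v j • h x) :=
      (lipschitzWith_smul (v j)).comp hh
    have hlt : ‖v j‖₊ * K < 1 := by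
      rw [← NNReal.coe_lt_coe]
      push_cast
      have hp : (0 : ℝ) < (K : ℝ) + 1 + j := by positivity
      rw [Real.norm_of_nonneg (by positivity), inv_mul_lt_one₀ hp]
      have : (0 : ℝ) ≤ ((j : ℕ) : ℝ) := by positivity
      linarith
    have := setIntegral_det_one_add_fderiv_of_lt_one hL hlt (r := r)
      (fun x hx => by rw [h0 x hx, smul_zero])
    rw [← hμ] at this
    rw [← this]
    refine integral_congr_ae (ae_restrict_of_ae ?_)
    filter_upwards [hh.ae_differentiableAt (μ := μ)] with x hx
    rw [fderiv_fun_const_smul hx]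
  have hsum : ∑ j, (Lagrange.basis Finset.univ v j).eval 1 = 1 := by
    rw [← Polynomial.eval_finsetSum, Lagrange.sum_basis hv.injOn Finset.univ_nonempty,
      Polynomial.eval_one]
  calc ∫ x in closedBall 0 r, (1 + fderiv ℝ h x).det ∂μ
      = ∫ x in closedBall 0 r, ∑ j, (Lagrange.basis Finset.univ v j).eval 1 *
          (1 + v j • fderiv ℝ h x).det ∂μ := by
        refine integral_congr_ae (Eventually.of_forall fun x => ?_)
        simpa using (fderiv ℝ h x).det_one_add_smul_eq_sum_basis v hv 1
    _ = ∑ j, (Lagrange.basis Finset.univ v j).eval 1 * μ.real (closedBall 0 r) := by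
        rw [integral_finsetSum]
        · exact Finset.sum_congr rfl fun j _ => by rw [integral_const_mul, hvj]
        · exact fun j _ => (integrableOn_det_one_add_smul_fderiv hh μ (v j) r).const_mul _
    _ = μ.real (closedBall 0 r) := by rw [← Finset.sum_mul, hsum, one_mul]

end VolumePreservation

/-! ### Metric projection onto closed convex sets. -/

section Projection
variable {E : Type*} [NormedAddCommGroup E] [InnerProductSpace ℝ E]

/-- The two inner products add up to `‖p - w‖ ^ 2`; this is uniqueness of the projection. -/
theorem eq_of_inner_sub_nonpos {x p w : E} (h1 : inner ℝ (x - p) (w - p) ≤ 0)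
    (h2 : inner ℝ (x - w) (p - w) ≤ 0) : p = w := by
  have h3 : inner ℝ (p - w) (p - w) ≤ 0 := by
    have : inner ℝ (p - w) (p - w) =
        inner ℝ (x - p) (w - p) + inner ℝ (x - w) (p - w) := by
      have e1 : w - p = -(p - w) := by abel
      have e2 : p - w = (x - w) - (x - p) := by abel
      rw [e1, inner_neg_right]
      conv_lhs => rw [e2, inner_sub_left, ← e2]
      ring
    linarith
  exact sub_eq_zero.1 (inner_self_eq_zero.1 (le_antisymm h3 real_inner_self_nonneg))

/-- The metric projection onto a nonempty closed convex set: it is characterised by the obtuse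
angle inequality and is nonexpansive. -/
theorem exists_metricProjection [CompleteSpace E] {s : Set E} (hne : s.Nonempty) (hcl : IsClosed s)
    (hcv : Convex ℝ s) :
    ∃ P : E → E, (∀ u, P u ∈ s) ∧ (∀ u, ∀ w ∈ s, inner ℝ (u - P u) (w - P u) ≤ 0) ∧
      LipschitzWith 1 P := by
  have hex : ∀ u, ∃ p ∈ s, ∀ w ∈ s, inner ℝ (u - p) (w - p) ≤ 0 := by
    intro u
    obtain ⟨p, hp, hmin⟩ := exists_norm_eq_iInf_of_complete_convex hne hcl.isComplete hcv u
    exact ⟨p, hp, (norm_eq_iInf_iff_real_inner_le_zero hcv hp).1 hmin⟩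
  choose P hPs hP using hex
  refine ⟨P, hPs, hP, LipschitzWith.of_dist_le_mul fun u v => ?_⟩
  rw [NNReal.coe_one, one_mul, dist_eq_norm, dist_eq_norm]
  have h1 := hP u (P v) (hPs v)
  have h2 := hP v (P u) (hPs u)
  have h3 : ‖P u - P v‖ ^ 2 ≤ inner ℝ (u - v) (P u - P v) := by
    rw [← real_inner_self_eq_norm_sq]
    have : inner ℝ (u - v) (P u - P v) - inner ℝ (P u - P v) (P u - P v) =
        -(inner ℝ (u - P u) (P v - P u)) - inner ℝ (v - P v) (P u - P v) := by
      have e1 : P v - P u = -(P u - P v) := by abel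
      rw [e1, inner_neg_right, neg_neg, ← inner_sub_left, ← inner_sub_left]
      congr 1
      abel
    linarith
  have h4 := real_inner_le_norm (u - v) (P u - P v)
  by_contra hlt
  push Not at hlt
  nlinarith [norm_nonneg (u - v), norm_nonneg (P u - P v)]

end Projection

/-! ### Lipschitz estimates for normalising a nonvanishing map. -/

section LipschitzSMul
variable {α F : Type*} [PseudoMetricSpace α] [NormedAddCommGroup F]

theorem LipschitzOnWith.smul_of_bounded [NormedSpace ℝ F] {φ : α → ℝ} {f : α → F} {s : Set α} {Kφ Kf a b : ℝ≥0}
    (hφ : LipschitzOnWith Kφ φ s) (hf : LipschitzOnWith Kf f s)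
    (ha : ∀ x ∈ s, ‖φ x‖ ≤ a) (hb : ∀ x ∈ s, ‖f x‖ ≤ b) :
    LipschitzOnWith (a * Kf + Kφ * b) (fun x => φ x • f x) s := by
  refine LipschitzOnWith.of_dist_le_mul fun x hx y hy => ?_
  have h1 := hφ.dist_le_mul x hx y hy
  have h2 := hf.dist_le_mul x hx y hy
  rw [dist_eq_norm] at h1 h2
  rw [dist_eq_norm]
  have e : φ x • f x - φ y • f y = φ x • (f x - f y) + (φ x - φ y) • f y := by
    rw [smul_sub, sub_smul]; abel
  calc ‖φ x • f x - φ y • f y‖ ≤ ‖φ x‖ * ‖f x - f y‖ + ‖φ x - φ y‖ * ‖f y‖ := by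
        rw [e, ← norm_smul, ← norm_smul]; exact norm_add_le _ _
    _ ≤ a * (Kf * dist x y) + (Kφ * dist x y) * b := by
        gcongr
        exacts [ha x hx, hb y hy]
    _ = ↑(a * Kf + Kφ * b) * dist x y := by push_cast; ring

theorem LipschitzOnWith.inv_norm {f : α → F} {s : Set α} {K δ : ℝ≥0}
    (hf : LipschitzOnWith K f s) (hδ : 0 < δ) (hb : ∀ x ∈ s, δ ≤ ‖f x‖) :
    LipschitzOnWith (K * (δ⁻¹ * δ⁻¹)) (fun x => ‖f x‖⁻¹) s := by
  refine LipschitzOnWith.of_dist_le_mul fun x hx y hy => ?_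
  have hδ' : (0 : ℝ) < δ := hδ
  have hx0 : 0 < ‖f x‖ := hδ'.trans_le (hb x hx)
  have hy0 : 0 < ‖f y‖ := hδ'.trans_le (hb y hy)
  have h1 := hf.dist_le_mul x hx y hy
  rw [dist_eq_norm] at h1
  rw [Real.dist_eq, inv_sub_inv hx0.ne' hy0.ne', abs_div, abs_of_pos (mul_pos hx0 hy0),
    div_eq_mul_inv, mul_inv]
  calc |‖f y‖ - ‖f x‖| * (‖f x‖⁻¹ * ‖f y‖⁻¹)
      ≤ (K * dist x y) * ((δ : ℝ)⁻¹ * (δ : ℝ)⁻¹) := by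
        gcongr
        · rw [abs_sub_comm]; exact (abs_norm_sub_norm_le _ _).trans h1
        · exact hb x hx
        · exact hb y hy
    _ = _ := by push_cast; ring

end LipschitzSMul

/-! ### No retraction, Brouwer, Hartman–Stampacchia. -/

section FixedPoint
variable {E : Type*} [NormedAddCommGroup E] [InnerProductSpace ℝ E] [FiniteDimensional ℝ E]

/-- The range lies in the orthogonal complement of `u`, so `L` is not surjective. -/
theorem ContinuousLinearMap.det_eq_zero_of_forall_inner_eq_zero {L : E →L[ℝ] E} {u : E}
    (hu : u ≠ 0) (h : ∀ v, inner ℝ u (L v) = 0) : L.det = 0 := by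
  by_contra hdet
  have hunit : IsUnit (L : E →ₗ[ℝ] E) :=
    (LinearMap.isUnit_iff_isUnit_det _).2 (isUnit_iff_ne_zero.2 hdet)
  obtain ⟨v, hv⟩ := ((Module.End.isUnit_iff _).1 hunit).2 u
  have h1 := h v
  have hv' : L v = u := hv
  rw [hv'] at h1
  exact hu (inner_self_eq_zero.1 h1)

/-- There is no Lipschitz retraction of a closed ball onto its boundary sphere. -/
theorem not_exists_lipschitz_retraction {ρ : E → E} {K : ℝ≥0} {r : ℝ} (hr : 0 < r)
    (hρ : LipschitzOnWith K ρ (closedBall 0 r)) (hnorm : ∀ x ∈ closedBall 0 r, ‖ρ x‖ = r)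
    (hid : ∀ x, ‖x‖ = r → ρ x = x) : False := by
  borelize E
  have : CompleteSpace E := FiniteDimensional.complete ℝ E
  obtain ⟨P, hPs, hP, hPL⟩ := exists_metricProjection (s := closedBall (0 : E) r)
    ⟨0, mem_closedBall_self hr.le⟩ isClosed_closedBall (convex_closedBall 0 r)
  have hP_in : ∀ x ∈ closedBall (0 : E) r, P x = x := fun x hx =>
    eq_of_inner_sub_nonpos (hP x x hx) (by simp)
  have hP_out : ∀ x, r ≤ ‖x‖ → ‖P x‖ = r := by
    intro x hx
    have hx0 : 0 < ‖x‖ := hr.trans_le hx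
    have hw : ‖(r / ‖x‖) • x‖ = r := by
      rw [norm_smul, Real.norm_of_nonneg (by positivity), div_mul_cancel₀ _ hx0.ne']
    have : P x = (r / ‖x‖) • x := by
      refine eq_of_inner_sub_nonpos (hP x _ (mem_closedBall_zero_iff.2 hw.le)) ?_
      have e : x - (r / ‖x‖) • x = (1 - r / ‖x‖) • x := by rw [sub_smul, one_smul]
      rw [e, real_inner_smul_left]
      refine mul_nonpos_of_nonneg_of_nonpos (sub_nonneg.2 ((div_le_one hx0).2 hx)) ?_
      rw [inner_sub_right, real_inner_smul_right, real_inner_self_eq_norm_sq]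
      have h1 := real_inner_le_norm x (P x)
      have h2 := mem_closedBall_zero_iff.1 (hPs x)
      have h3 : r / ‖x‖ * ‖x‖ ^ 2 = ‖x‖ * r := by field_simp
      nlinarith
    rw [this, hw]
  -- Subtracting `P x` rather than `x` makes `h` vanish outside the ball, while `id + h` still
  -- equals `ρ` on it.
  let h : E → E := fun x => ρ (P x) - P x
  have hρP : LipschitzWith K fun x => ρ (P x) := by
    have := hρ.comp (hPL.lipschitzOnWith (s := Set.univ)) (fun x _ => hPs x)
    rw [mul_one] at this
    exact lipschitzOnWith_univ.1 this
  have hh : LipschitzWith (K + 1) h := hρP.sub hPL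
  have h0 : ∀ x, r ≤ ‖x‖ → h x = 0 := fun x hx => sub_eq_zero.2 (hid _ (hP_out x hx))
  have hint := setIntegral_det_one_add_fderiv hh h0
  set μ : Measure E := μH[finrank ℝ E] with hμ
  have hzero : ∫ x in closedBall 0 r, (1 + fderiv ℝ h x).det ∂μ = 0 := by
    have hae : ∀ᵐ x ∂(μ.restrict (closedBall 0 r)), (1 + fderiv ℝ h x).det = 0 := by
      rw [ae_restrict_iff' isClosed_closedBall.measurableSet]
      have hs : ∀ᵐ x ∂μ, x ∉ sphere (0 : E) r := by
        refine compl_mem_ae_iff.2 ?_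
        exact Measure.addHaar_sphere_of_ne_zero μ 0 hr.ne'
      filter_upwards [hh.ae_differentiableAt (μ := μ), hs] with x hx hxs hxb
      have hxball : x ∈ ball (0 : E) r := by
        rw [mem_ball_zero_iff]
        rw [mem_sphere_zero_iff_norm] at hxs
        exact lt_of_le_of_ne (mem_closedBall_zero_iff.1 hxb) hxs
      let g : E → E := fun y => y + h y
      have hg : HasFDerivAt g (1 + fderiv ℝ h x) x := (hasFDerivAt_id x).add hx.hasFDerivAt
      have hgρ : ∀ y ∈ ball (0 : E) r, g y = ρ y := fun y hy => by
        simp [g, h, hP_in y (ball_subset_closedBall hy)]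
      -- Differentiating `‖g‖ ^ 2 = r ^ 2` shows that the derivative of `g` has range orthogonal to
      -- `g x`.
      have hconst : (fun y => inner ℝ (g y) (g y)) =ᶠ[nhds x] fun _ => r ^ 2 := by
        filter_upwards [isOpen_ball.mem_nhds hxball] with y hy
        rw [real_inner_self_eq_norm_sq, hgρ y hy, hnorm y (ball_subset_closedBall hy)]
      have hd := (hg.inner ℝ hg).unique ((hasFDerivAt_const (r ^ 2) x).congr_of_eventuallyEq hconst)
      refine ContinuousLinearMap.det_eq_zero_of_forall_inner_eq_zero (u := g x) ?_ fun v => ?_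
      · rw [← norm_pos_iff, hgρ x hxball, hnorm x hxb]; exact hr
      · have h1 := DFunLike.congr_fun hd v
        simp only [ContinuousLinearMap.comp_apply, ContinuousLinearMap.prod_apply,
          fderivInnerCLM_apply, zero_apply] at h1
        rw [real_inner_comm (g x)] at h1
        linarith
    rw [integral_congr_ae hae, integral_zero]
  rw [hzero] at hint
  have : ProperSpace E := FiniteDimensional.proper_real E
  have hpos : 0 < μ.real (closedBall (0 : E) r) :=
    ENNReal.toReal_pos (measure_closedBall_pos μ 0 hr).ne'
      (isCompact_closedBall (0 : E) r).measure_lt_top.ne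
  exact hpos.ne hint

/-- Brouwer's fixed point theorem for bounded Lipschitz maps. -/
theorem LipschitzWith.exists_fixedPoint_of_bounded {f : E → E} {K M : ℝ≥0} (hf : LipschitzWith K f)
    (hM : ∀ x, ‖f x‖ ≤ M) : ∃ x, f x = x := by
  by_contra! hne
  have : ProperSpace E := FiniteDimensional.proper_real E
  let a : ℝ≥0 := M + 1
  have ha : (0 : ℝ) < a := by positivity
  have hMa : (M : ℝ) < a := by simp [a]
  let B : Set E := closedBall 0 (2 * a)
  -- A cutoff equal to `1` for `‖x‖ ≤ a` and to `0` for `‖x‖ = 2 * a`. A zero of `g` has norm at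
  -- most `M < a`, so it would be a fixed point of `f`; on the sphere `g` is the identity, so `2a
  -- g/‖g‖` is a retraction.
  let φ : E → ℝ := fun x => min 1 (2 - (a⁻¹ : ℝ≥0) * ‖x‖)
  have hφL : LipschitzWith (0 + a⁻¹ * 1) φ := by
    refine LipschitzWith.const_min ?_ 1
    refine (LipschitzWith.const 2).sub ?_
    have h1 : LipschitzWith a⁻¹ fun t : ℝ => (a⁻¹ : ℝ≥0) * t := by
      have := lipschitzWith_smul (β := ℝ) ((a⁻¹ : ℝ≥0) : ℝ)
      simpa using this
    exact h1.comp lipschitzWith_one_norm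
  have hφ0 : ∀ x ∈ B, 0 ≤ φ x := by
    intro x hx
    have hx' : ‖x‖ ≤ 2 * a := mem_closedBall_zero_iff.1 hx
    refine le_min zero_le_one (sub_nonneg.2 ?_)
    rw [NNReal.coe_inv, inv_mul_le_iff₀ ha]
    linarith
  have hφ1 : ∀ x ∈ B, ‖φ x‖ ≤ (1 : ℝ≥0) := fun x hx => by
    rw [Real.norm_of_nonneg (hφ0 x hx)]
    exact min_le_left _ _
  let g : E → E := fun x => x - φ x • f x
  obtain ⟨Kg, hg⟩ : ∃ Kg, LipschitzOnWith Kg g B :=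
    ⟨_, LipschitzWith.id.lipschitzOnWith.sub
      (hφL.lipschitzOnWith.smul_of_bounded hf.lipschitzOnWith hφ1 fun x _ => hM x)⟩
  have hg0 : ∀ x ∈ B, g x ≠ 0 := by
    intro x hx h0
    have hx1 : x = φ x • f x := sub_eq_zero.1 h0
    have hxM : ‖x‖ ≤ M := by
      calc ‖x‖ = ‖φ x‖ * ‖f x‖ := by rw [← norm_smul, ← hx1]
        _ ≤ (1 : ℝ≥0) * M := by gcongr; exacts [hφ1 x hx, hM x]
        _ = M := by simp
    have hφx : φ x = 1 := by
      refine min_eq_left ?_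
      have : ((a⁻¹ : ℝ≥0) : ℝ) * ‖x‖ ≤ 1 := by
        rw [NNReal.coe_inv, inv_mul_le_iff₀ ha]
        linarith
      linarith
    rw [hφx, one_smul] at hx1
    exact hne x hx1.symm
  have hgb : ∀ x ∈ B, ‖g x‖ ≤ (3 * a : ℝ≥0) := by
    intro x hx
    have hx' : ‖x‖ ≤ 2 * a := mem_closedBall_zero_iff.1 hx
    have h1 : ‖φ x • f x‖ ≤ (1 : ℝ≥0) * M := by
      rw [norm_smul]; gcongr; exacts [hφ1 x hx, hM x]
    calc ‖g x‖ ≤ ‖x‖ + ‖φ x • f x‖ := _root_.norm_sub_le _ _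
      _ ≤ 2 * a + (1 : ℝ≥0) * M := add_le_add hx' h1
      _ ≤ (3 * a : ℝ≥0) := by push_cast; linarith
  have hBne : B.Nonempty := ⟨0, mem_closedBall_self (by positivity)⟩
  obtain ⟨x₀, hx₀, hmin⟩ := (isCompact_closedBall (0 : E) (2 * a)).exists_isMinOn hBne
    hg.continuousOn.norm
  let δ : ℝ≥0 := ‖g x₀‖₊
  have hδ : 0 < δ := nnnorm_pos.2 (hg0 x₀ hx₀)
  have hδg : ∀ x ∈ B, δ ≤ ‖g x‖ := fun x hx => hmin hx
  have hinv : LipschitzOnWith _ (fun x => ‖g x‖⁻¹ • g x) B :=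
    (hg.inv_norm hδ hδg).smul_of_bounded (a := δ⁻¹) hg (fun x hx => by
      rw [norm_inv, norm_norm, NNReal.coe_inv]
      exact inv_anti₀ hδ (hδg x hx)) hgb
  have hret := (lipschitzWith_smul (β := E) (2 * a : ℝ)).comp_lipschitzOnWith hinv
  refine not_exists_lipschitz_retraction (r := 2 * a) (by positivity) hret (fun x hx => ?_)
    fun x hx => ?_
  · have : ‖g x‖ ≠ 0 := norm_ne_zero_iff.2 (hg0 x hx)
    simp only [Function.comp_apply]
    rw [norm_smul, norm_smul, norm_inv, norm_norm, inv_mul_cancel₀ this, mul_one,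
      Real.norm_of_nonneg (by positivity)]
  · have hφx : φ x = 0 := by
      have : ((a⁻¹ : ℝ≥0) : ℝ) * ‖x‖ = 2 := by
        rw [hx, NNReal.coe_inv]; field_simp
      simp only [φ, this]
      norm_num
    have hgx : g x = x := by simp [g, hφx]
    simp only [Function.comp_apply]
    rw [hgx, hx, smul_smul, mul_inv_cancel₀ (by positivity), one_smul]

/-- The Hartman–Stampacchia theorem for Lipschitz maps on compact convex sets. -/
theorem exists_variationalInequality_solution {s : Set E} (hne : s.Nonempty) (hs : IsCompact s)
    (hcv : Convex ℝ s) {F : E → E} {K : ℝ≥0} (hF : LipschitzOnWith K F s) :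
    ∃ x ∈ s, ∀ y ∈ s, 0 ≤ inner ℝ (y - x) (F x) := by
  have : CompleteSpace E := FiniteDimensional.complete ℝ E
  obtain ⟨P, hPs, hP, hPL⟩ := exists_metricProjection hne hs.isClosed hcv
  have hFP : LipschitzWith K fun x => F (P x) := by
    have := hF.comp (hPL.lipschitzOnWith (s := Set.univ)) (fun x _ => hPs x)
    rw [mul_one] at this
    exact lipschitzOnWith_univ.1 this
  obtain ⟨M, hM⟩ := hs.isBounded.exists_norm_le
  -- Inserting `P` before `F` gives a map Lipschitz on all of `E`; its fixed points lie in `s`, and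
  -- there the obtuse angle inequality is the variational inequality.
  obtain ⟨x, hx⟩ := (hPL.comp (hPL.sub hFP)).exists_fixedPoint_of_bounded (M := M.toNNReal)
    fun x => (hM _ (hPs _)).trans (Real.le_coe_toNNReal M)
  replace hx : P (P x - F (P x)) = x := hx
  have hxs : x ∈ s := hx ▸ hPs _
  have hPx : P x = x := eq_of_inner_sub_nonpos (hP x x hxs) (by simp)
  refine ⟨x, hxs, fun y hy => ?_⟩
  have := hP (P x - F (P x)) y hy
  rw [hx, hPx, sub_sub_cancel_left, inner_neg_left, real_inner_comm] at this
  linarith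

end FixedPoint

/-! ### Growth and coercivity of positive definite tensors. -/

namespace RealTensor
variable {m n : ℕ}

theorem contDiff_applyVec (A : RealTensor m n) : ContDiff ℝ 1 A.applyVec := by
  rw [contDiff_euclidean]
  intro i
  refine ContDiff.sum fun j _ => contDiff_const.mul (contDiff_prod fun k _ => ?_)
  exact (contDiff_euclidean.1 contDiff_id) (j k)

theorem continuous_applyScalar (A : RealTensor m n) : Continuous A.applyScalar := by
  unfold applyScalar
  fun_prop

theorem applyScalar_smul (A : RealTensor m n) (c : ℝ) (x : EuclideanSpace ℝ (Fin n)) :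
    A.applyScalar (c • x) = c ^ m * A.applyScalar x := by
  simp only [applyScalar, Finset.mul_sum, PiLp.smul_apply, smul_eq_mul, Finset.prod_mul_distrib,
    Finset.prod_const, Finset.card_univ, Fintype.card_fin]
  exact Finset.sum_congr rfl fun j _ => by ring

theorem inner_applyVec (hm : m ≠ 0) (A : RealTensor m n) (x : EuclideanSpace ℝ (Fin n)) :
    inner ℝ x (A.applyVec x) = A.applyScalar x := by
  obtain ⟨k, rfl⟩ := Nat.exists_eq_succ_of_ne_zero hm
  have hcons : ∀ (i : Fin n) (j : Fin k → Fin n),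
      consIndex (m := k + 1) i j = Fin.cons (α := fun _ => Fin n) i j := by
    intro i j
    ext l
    refine Fin.cases ?_ (fun l => ?_) l
    · simp [consIndex]
    · simp [consIndex]
  rw [applyScalar, ← (Fin.consEquiv fun _ : Fin (k + 1) => Fin n).sum_comp,
    Fintype.sum_prod_type, PiLp.inner_apply]
  refine Finset.sum_congr rfl fun i _ => ?_
  simp only [applyVec, RCLike.inner_apply, conj_trivial, Finset.sum_mul]
  refine Finset.sum_congr rfl fun j _ => ?_
  rw [hcons]
  simp only [Fin.consEquiv, Equiv.coe_fn_mk, Fin.prod_univ_succ, Fin.cons_zero, Fin.cons_succ]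
  simp
  ring

variable {X : Set (EuclideanSpace ℝ (Fin n))}

/-- The constant is the minimum of `𝒜x^m` over `X ∩ sphere 0 1`. Since `X` need not be a cone, `x /
‖x‖ ∈ X` is available only for `‖x‖ ≥ 1`, from convexity and `0 ∈ X`. -/
theorem PosDefOn.exists_pos_mul_norm_pow_le {A : RealTensor m n} (hA : A.PosDefOn X)
    (hcl : IsClosed X) (hcv : Convex ℝ X) (h0 : (0 : EuclideanSpace ℝ (Fin n)) ∈ X) :
    ∃ c : ℝ, 0 < c ∧ ∀ x ∈ X, 1 ≤ ‖x‖ → c * ‖x‖ ^ m ≤ A.applyScalar x := by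
  have hunit : ∀ x ∈ X, 1 ≤ ‖x‖ → ‖x‖⁻¹ • x ∈ X ∩ sphere 0 1 := by
    intro x hx h1
    have hpos : 0 < ‖x‖ := zero_lt_one.trans_le h1
    refine ⟨hcv.smul_mem_of_zero_mem h0 hx ⟨by positivity, inv_le_one_of_one_le₀ h1⟩, ?_⟩
    rw [mem_sphere_zero_iff_norm, norm_smul, norm_inv, norm_norm, inv_mul_cancel₀ hpos.ne']
  rcases (X ∩ sphere (0 : EuclideanSpace ℝ (Fin n)) 1).eq_empty_or_nonempty with hS | hS
  · exact ⟨1, one_pos, fun x hx h1 => absurd (hunit x hx h1) (by simp [hS])⟩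
  · obtain ⟨u, hu, hmin⟩ := ((isCompact_sphere (0 : EuclideanSpace ℝ (Fin n)) 1).inter_left
      hcl).exists_isMinOn hS A.continuous_applyScalar.continuousOn
    refine ⟨A.applyScalar u, hA u hu.1 (ne_zero_of_mem_unit_sphere ⟨u, hu.2⟩), fun x hx h1 => ?_⟩
    have hpos : 0 < ‖x‖ := zero_lt_one.trans_le h1
    have hle : A.applyScalar u ≤ A.applyScalar (‖x‖⁻¹ • x) := hmin (hunit x hx h1)
    rw [applyScalar_smul, inv_pow] at hle
    rw [mul_comm]
    exact (le_inv_mul_iff₀ (by positivity)).1 hle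

/-- A positive definite tensor defines a coercive map. -/
theorem PosDefOn.exists_norm_le_of_inner_nonpos {A : RealTensor m n} (hA : A.PosDefOn X)
    (hm : 2 ≤ m) (hcl : IsClosed X) (hcv : Convex ℝ X)
    (h0 : (0 : EuclideanSpace ℝ (Fin n)) ∈ X) (q : EuclideanSpace ℝ (Fin n)) :
    ∃ R : ℝ, 0 ≤ R ∧ ∀ x ∈ X, inner ℝ x (A.applyVec x + q) ≤ 0 → ‖x‖ ≤ R := by
  obtain ⟨c, hc, hcoer⟩ := hA.exists_pos_mul_norm_pow_le hcl hcv h0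
  refine ⟨max 1 (‖q‖ / c), zero_le_one.trans (le_max_left _ _), fun x hx hle => ?_⟩
  rcases le_total ‖x‖ 1 with h1 | h1
  · exact h1.trans (le_max_left _ _)
  · refine le_trans ?_ (le_max_right _ _)
    rw [inner_add_right, inner_applyVec (by omega)] at hle
    have h2 := hcoer x hx h1
    have h3 := (abs_le.1 (abs_real_inner_le_norm x q)).1
    have h4 : ‖x‖ ^ 2 ≤ ‖x‖ ^ m := pow_le_pow_right₀ h1 hm
    have h5 : c * ‖x‖ ^ 2 ≤ c * ‖x‖ ^ m := by gcongr
    rw [le_div_iff₀ hc]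
    have h6 : ‖x‖ * (‖x‖ * c) ≤ ‖x‖ * ‖q‖ := by nlinarith
    exact le_of_mul_le_mul_left h6 (zero_lt_one.trans_le h1)

end RealTensor

/-! ### Removing the truncation for coercive maps. -/

section Coercive
variable {n : ℕ} {X : Set (EuclideanSpace ℝ (Fin n))}
  {F : EuclideanSpace ℝ (Fin n) → EuclideanSpace ℝ (Fin n)}

theorem isClosed_viSolutionSet (hcl : IsClosed X) (hF : Continuous F) :
    IsClosed (viSolutionSet X F) := by
  have : viSolutionSet X F = X ∩ ⋂ y ∈ X, {x | 0 ≤ inner ℝ (y - x) (F x)} := by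
    ext x
    simp [viSolutionSet]
  rw [this]
  exact hcl.inter (isClosed_biInter fun y _ => isClosed_le continuous_const (by fun_prop))

theorem viSolutionSet_nonempty_of_coercive (hcl : IsClosed X) (hcv : Convex ℝ X)
    (h0 : (0 : EuclideanSpace ℝ (Fin n)) ∈ X) (hF : ContDiff ℝ 1 F) {R : ℝ} (hR : 0 ≤ R)
    (hco : ∀ x ∈ X, inner ℝ x (F x) ≤ 0 → ‖x‖ ≤ R) : (viSolutionSet X F).Nonempty := by
  let s := X ∩ closedBall 0 (R + 1)
  have hs : IsCompact s := (isCompact_closedBall _ _).inter_left hcl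
  have hscv : Convex ℝ s := hcv.inter (convex_closedBall _ _)
  have h0s : (0 : EuclideanSpace ℝ (Fin n)) ∈ s := ⟨h0, mem_closedBall_self (by linarith)⟩
  obtain ⟨K, hK⟩ := hF.contDiffOn.exists_lipschitzOnWith one_ne_zero hscv hs
  obtain ⟨x, hx, hsol⟩ := exists_variationalInequality_solution ⟨0, h0s⟩ hs hscv hK
  have hxR : ‖x‖ ≤ R := hco x hx.1 (by simpa using hsol 0 h0s)
  refine ⟨x, hx.1, fun y hy => ?_⟩
  have hpos : 0 < 1 + ‖y - x‖ := by positivity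
  -- This makes the step `t • (y - x)` no longer than `1`, so from `‖x‖ ≤ R` it stays within radius
  -- `R + 1`.
  let t : ℝ := (1 + ‖y - x‖)⁻¹
  have ht : 0 < t := inv_pos.2 hpos
  have ht1 : t ≤ 1 := inv_le_one_of_one_le₀ (by linarith [norm_nonneg (y - x)])
  have hz : x + t • (y - x) ∈ s := by
    refine ⟨hcv.add_smul_sub_mem hx.1 hy ⟨ht.le, ht1⟩, mem_closedBall_zero_iff.2 ?_⟩
    have h1 : ‖t • (y - x)‖ ≤ 1 := by
      rw [norm_smul, Real.norm_of_nonneg ht.le]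
      exact (inv_mul_le_one₀ hpos).2 (by linarith)
    exact (norm_add_le _ _).trans (add_le_add hxR h1)
  have h2 := hsol _ hz
  rw [add_sub_cancel_left, real_inner_smul_left] at h2
  exact nonneg_of_mul_nonneg_right h2 ht

end Coercive

end

theorem theorem4p2 (m n : ℕ) (hm : 2 ≤ m) (X : Set (EuclideanSpace ℝ (Fin n)))
    (hX_nonempty : X.Nonempty) (hX_closed : IsClosed X) (hX_convex : Convex ℝ X)
    (hX_zero : (0 : EuclideanSpace ℝ (Fin n)) ∈ X)
    (A : RealTensor m n) (hA : A.PosDefOn X) (q : EuclideanSpace ℝ (Fin n)) :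
    (tviSolutionSet X A q).Nonempty ∧ IsCompact (tviSolutionSet X A q) := by
  obtain ⟨R, hR, hco⟩ := hA.exists_norm_le_of_inner_nonpos hm hX_closed hX_convex hX_zero q
  have hF : ContDiff ℝ 1 fun x => A.applyVec x + q := A.contDiff_applyVec.add contDiff_const
  refine ⟨viSolutionSet_nonempty_of_coercive hX_closed hX_convex hX_zero hF hR hco, ?_⟩
  refine (isCompact_closedBall 0 R).of_isClosed_subset
    (isClosed_viSolutionSet hX_closed hF.continuous) fun x hx => ?_
  exact mem_closedBall_zero_iff.2 (hco x hx.1 (by simpa using hx.2 0 hX_zero))
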